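/- **Model.** Let $x\in\{0,1\}^n$ be an input, accessed through the phase oracle $O_x|i,b\rangle=(-1)^{x(i)\,b}|i,b\rangle$ ($i\in[n]$, $b\in\{0,1\}$), acting as the identity on a finite workspace. A *PDQP query algorithm* (quantum query algorithm with non-collapsing measurements) is a finite circuit started in a fixed computational basis state. Each step applies an arbitrary fixed unitary $U_i$, then a (possibly trivial) collapsing partial measurement $M_i$ in the computational basis, and then either applies $O_x$ (a query step) or draws a sample $v_i$ of a complete computational-basis measurement of the current state $|\phi_i\rangle$ without disturbing that state (a non-collapsing measurement step). The output is a deterministic function of the list of samples $v_i$. Let $Q$ be the number of query steps and $P$ the number of non-collapsing measurement steps. A PDQP query algorithm *with non-adaptive queries* has the form $M_PU_P\cdots M_1U_1\,O_x^{Q}\,U_0|\mathrm{init}\rangle$, where $|\mathrm{init}\rangle$ is a fixed computational basis state and $O_x^{Q}|i_1,b_1,\dots,i_Q,b_Q\rangle=(-1)^{\sum_j x(i_j)b_j}|i_1,b_1,\dots,i_Q,b_Q\rangle$ is a single parallel application of $Q$ queries, with one non-collapsing measurement after each of the $P$ pairs $(U_i,M_i)$, $1\le i\le P$, and its output is again a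 deterministic function of the $P$ samples. An algorithm solves $f:\{0,1\}^n\to\{0,1\}$ with error $\varepsilon$ if on every input $x$ it outputs $f(x)$ with probability at least $1-\varepsilon$. **Statement.** For every $\varepsilon\in[0,1/2)$ (for instance $\varepsilon=1/3$) there is a constant $c>0$, depending only on $\varepsilon$, such that the following holds for all $n$. Let $f:\{0,1\}^n\to\{0,1\}$, let $X\subseteq f^{-1}(1)$ and $Y\subseteq f^{-1}(0)$ be non-empty, and let $R\subseteq X\times Y$. Put $$m=\min_{x\in X}|\{y:(x,y)\in R\}|,\qquad m'=\min_{y\in Y}|\{x:(x,y)\in R\}|,$$ $$l=\max_{x\in X,\,i\in[n]}|\{y:(x,y)\in R,\ x(i)\ne y(i)\}|,\qquad l'=\max_{y\in Y,\,i\in[n]}|\{x:(x,y)\in R,\ x(i)\ne y(i)\}|.$$ (If $R\neq\emptyset$ then $l,l'\ge1$; if $R=\emptyset$, so that $m=m'=l=l'=0$, the quotients below are read as $0$.) 1. Every PDQP query algorithm that solves $f$ with error $\varepsilon$ using $Q$ queries and $P$ non-collapsing measurements satisfies $$QP\ \ge\ c\,\sqrt{\frac{m\,m'}{l\,l'}}.$$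 2. Every PDQP query algorithm with non-adaptive queries that solves $f$ with error $\varepsilon$ using $Q$ queries and $P$ non-collapsing measurements satisfies $$QP\ \ge\ c\,\max\left\{\frac{m}{l},\ \frac{m'}{l'}\right\}.$$ -/

import Mathlib

open Finset

noncomputable section

namespace PDQP

/-! ### Pure states and the elementary operations on a register

A (not necessarily normalised) state of a register with computational basis `S` is its vector of
amplitudes `φ : S → ℂ`. -/

/-- The squared Euclidean norm of a state. -/
def normSq {S : Type} [Fintype S] (φ : S → ℂ) : ℝ := ∑ s, ‖φ s‖ ^ 2

/-- The state `φ` divided by its Euclidean norm (and `0` if `φ = 0`). -/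
def normalized {S : Type} [Fintype S] (φ : S → ℂ) : S → ℂ :=
  fun s => φ s / ((Real.sqrt (normSq φ) : ℝ) : ℂ)

/-- The computational basis state `|s₀⟩`. -/
def basisState {S : Type} [DecidableEq S] (s₀ : S) : S → ℂ := Pi.single s₀ 1

/-- One pair `(U, M)` of a circuit: a unitary `U` followed by a collapsing partial measurement `M`
in the computational basis. `M` reads the part `label s` of the basis string `s`; reading off a
set of qubits is the case where `label` restricts `s` to these qubits, and a constant `label` is
the empty measurement. -/
structure Gate (S : Type) [Fintype S] [DecidableEq S] where
  U : Matrix.unitaryGroup S ℂ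
  outcomes : ℕ
  label : S → Fin outcomes

/-- The unnormalised state `Π_k U φ`, where `Π_k` is the projector of the outcome `k` of `M`. The
outcome `k` occurs with probability `normSq (g.branch k φ)` on a unit vector `φ`. -/
def Gate.branch {S : Type} [Fintype S] [DecidableEq S] (g : Gate S) (k : Fin g.outcomes)
    (φ : S → ℂ) : S → ℂ :=
  fun s => if g.label s = k then ((g.U : Matrix S S ℂ).mulVec φ) s else 0

/-- What happens after the pair `(U, M)` of a step: either a query to the input, or a non-collapsing
measurement of the whole register. -/
inductive StepKind where
  | query
  | sample

/-- A step of a circuit. -/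
structure Step (S : Type) [Fintype S] [DecidableEq S] where
  gate : Gate S
  kind : StepKind

def Step.isQuery {S : Type} [Fintype S] [DecidableEq S] (s : Step S) : Bool :=
  match s.kind with
  | .query => true
  | .sample => false

/-- The number of query steps. -/
def numQueries {S : Type} [Fintype S] [DecidableEq S] (C : List (Step S)) : ℕ :=
  C.countP (fun s => s.isQuery)

/-- The number of steps with a non-collapsing measurement. -/
def numSamples {S : Type} [Fintype S] [DecidableEq S] (C : List (Step S)) : ℕ :=
  C.countP (fun s => !s.isQuery)

/-- `samplesProb O C φ vs` is the probability that the circuit `C`, started in the unit vector `φ`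
and with the oracle gate `O`, returns the list `vs` of results of its non-collapsing measurements.

In each step, `U` is applied and `M` collapses the state to the normalised `ψ = Π_k U φ / ‖Π_k U φ‖`
with probability `‖Π_k U φ‖ ^ 2`. In a query step the computation goes on with `O ψ`. In the
other steps a result `v` is drawn with probability `|⟨v|ψ⟩| ^ 2` and the computation goes on with
the *same* state `ψ`. -/
def samplesProb {S : Type} [Fintype S] [DecidableEq S] (O : (S → ℂ) → (S → ℂ)) :
    List (Step S) → (S → ℂ) → List S → ℝ
  | [], _, [] => 1
  | [], _, _ :: _ => 0
  | ⟨g, .query⟩ :: C, φ, vs =>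
      ∑ k, normSq (g.branch k φ) * samplesProb O C (O (normalized (g.branch k φ))) vs
  | ⟨_, .sample⟩ :: _, _, [] => 0
  | ⟨g, .sample⟩ :: C, φ, v :: vs =>
      ∑ k, normSq (g.branch k φ) *
        (‖normalized (g.branch k φ) v‖ ^ 2 * samplesProb O C (normalized (g.branch k φ)) vs)

/-! ### Query algorithms -/

/-- The basis of a register that consists of an index `i`, a bit `b` and a workspace. -/
abbrev Basis (n w : ℕ) : Type := Fin n × Bool × Fin w

/-- The phase oracle `O_x : |i, b, z⟩ ↦ (-1) ^ (x(i) * b) |i, b, z⟩`. -/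
def phaseOracle {n w : ℕ} (x : Fin n → Bool) (φ : Basis n w → ℂ) : Basis n w → ℂ :=
  fun s => (-1) ^ ((x s.1).toNat * s.2.1.toNat) * φ s

/-- A query algorithm with non-collapsing measurements on inputs from `{0,1}ⁿ`: a circuit, started
in a basis state, and a deterministic post-processing of the results of its non-collapsing
measurements. -/
structure Algorithm (n : ℕ) where
  w : ℕ
  init : Basis n w
  circuit : List (Step (Basis n w))
  post : List (Basis n w) → Bool

/-- The number `Q` of queries. -/
def Algorithm.Q {n : ℕ} (A : Algorithm n) : ℕ := numQueries A.circuit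

/-- The number `P` of non-collapsing measurements. -/
def Algorithm.P {n : ℕ} (A : Algorithm n) : ℕ := numSamples A.circuit

/-- The probability that the algorithm outputs `b` on the input `x`. -/
def Algorithm.outputProb {n : ℕ} (A : Algorithm n) (x : Fin n → Bool) (b : Bool) : ℝ :=
  ∑ v : Fin A.P → Basis n A.w,
    if A.post (List.ofFn v) = b then
      samplesProb (phaseOracle x) A.circuit (basisState A.init) (List.ofFn v)
    else 0

/-- The algorithm computes `f` with error probability at most `ε` on every input. -/
def Algorithm.Solves {n : ℕ} (A : Algorithm n) (f : (Fin n → Bool) → Bool) (ε : ℝ) : Prop :=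
  ∀ x, 1 - ε ≤ A.outputProb x (f x)

/-- The basis of a register that consists of `Q` pairs `(i_j, b_j)` and a workspace. -/
abbrev ParBasis (n Q w : ℕ) : Type := (Fin Q → Fin n × Bool) × Fin w

/-- The parallel query
`O_x^Q : |i_1, b_1, …, i_Q, b_Q, z⟩ ↦ (-1) ^ (∑_j x(i_j) * b_j) |i_1, b_1, …, i_Q, b_Q, z⟩`. -/
def parallelOracle {n Q w : ℕ} (x : Fin n → Bool) (φ : ParBasis n Q w → ℂ) :
    ParBasis n Q w → ℂ :=
  fun s => (-1) ^ (∑ j, (x (s.1 j).1).toNat * (s.1 j).2.toNat) * φ s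

/-- A query algorithm with non-collapsing measurements and non-adaptive queries,
`M_P U_P ⋯ M_1 U_1 O_x^Q U_0 |init⟩`, with a non-collapsing measurement after each of the gates
`(U_1, M_1), …, (U_P, M_P)` and a deterministic post-processing of the results. -/
structure NonAdaptiveAlgorithm (n : ℕ) where
  /-- The number of queries. -/
  Q : ℕ
  w : ℕ
  init : ParBasis n Q w
  U₀ : Matrix.unitaryGroup (ParBasis n Q w) ℂ
  gates : List (Gate (ParBasis n Q w))
  post : List (ParBasis n Q w) → Bool

/-- The number `P` of non-collapsing measurements. -/
def NonAdaptiveAlgorithm.P {n : ℕ} (A : NonAdaptiveAlgorithm n) : ℕ := A.gates.length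

/-- The state `O_x^Q U_0 |init⟩`. -/
def NonAdaptiveAlgorithm.queriedState {n : ℕ} (A : NonAdaptiveAlgorithm n) (x : Fin n → Bool) :
    ParBasis n A.Q A.w → ℂ :=
  parallelOracle x
    ((A.U₀ : Matrix (ParBasis n A.Q A.w) (ParBasis n A.Q A.w) ℂ).mulVec (basisState A.init))

/-- The probability that the algorithm outputs `b` on the input `x`. There is no query
after the initial one, so the oracle argument of `samplesProb` is irrelevant here. -/
def NonAdaptiveAlgorithm.outputProb {n : ℕ} (A : NonAdaptiveAlgorithm n) (x : Fin n → Bool)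
    (b : Bool) : ℝ :=
  ∑ v : Fin A.P → ParBasis n A.Q A.w,
    if A.post (List.ofFn v) = b then
      samplesProb (parallelOracle x) (A.gates.map fun g => ⟨g, .sample⟩)
        (A.queriedState x) (List.ofFn v)
    else 0

/-- The algorithm computes `f` with error probability at most `ε` on every input. -/
def NonAdaptiveAlgorithm.Solves {n : ℕ} (A : NonAdaptiveAlgorithm n)
    (f : (Fin n → Bool) → Bool) (ε : ℝ) : Prop :=
  ∀ x, 1 - ε ≤ A.outputProb x (f x)

/-! ### The parameters of the basic adversary method -/

/-- `m`: the minimum over `x ∈ X` of the number of pairs `(x, y) ∈ R`. -/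
def degX {n : ℕ} (X : Finset (Fin n → Bool)) (hX : X.Nonempty)
    (R : Finset ((Fin n → Bool) × (Fin n → Bool))) : ℕ :=
  X.inf' hX fun x => #{p ∈ R | p.1 = x}

/-- `m'`: the minimum over `y ∈ Y` of the number of pairs `(x, y) ∈ R`. -/
def degY {n : ℕ} (Y : Finset (Fin n → Bool)) (hY : Y.Nonempty)
    (R : Finset ((Fin n → Bool) × (Fin n → Bool))) : ℕ :=
  Y.inf' hY fun y => #{p ∈ R | p.2 = y}

/-- `l`: the maximum over `x ∈ X` and `i` of the number of pairs `(x, y) ∈ R` with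
`x(i) ≠ y(i)`. -/
def loadX {n : ℕ} (X : Finset (Fin n → Bool))
    (R : Finset ((Fin n → Bool) × (Fin n → Bool))) : ℕ :=
  X.sup fun x => univ.sup fun i => #{p ∈ R | p.1 = x ∧ p.1 i ≠ p.2 i}

/-- `l'`: the maximum over `y ∈ Y` and `i` of the number of pairs `(x, y) ∈ R` with
`x(i) ≠ y(i)`. -/
def loadY {n : ℕ} (Y : Finset (Fin n → Bool))
    (R : Finset ((Fin n → Bool) × (Fin n → Bool))) : ℕ :=
  Y.sup fun y => univ.sup fun i => #{p ∈ R | p.2 = y ∧ p.1 i ≠ p.2 i}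

end PDQP

end

/-! For `(x, y)` in `R`, the distributions of the sample lists on `x` and on `y` are compared
through their Bhattacharyya coefficient `fid`. Correctness with error `ε < 1/2` forces it down to `1
- (1 - 2ε)²/2` for every pair (`sum_sqrt_mul_sqrt_le_of_distinguish`), so it suffices to show that
few queries and samples keep it large in total over `R`.

All collapse branches are followed at once as unnormalised states, pairing equal outcomes on `x` and
`y`. Summed over branches, a gate does not lower the overlap and does not raise the product of
norms. A sample lowers the fidelity by at most the gap between norm product and overlap. A query
lowers the total overlap by at most a weighted sum of squared norms, and gates conserve that sum.
Hence in `le_sum_fid` the losses add up: each of `N` samples sees the gap caused by at most `Q`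
queries, and the final fidelity pays for it once more, which gives `(N + 1) * Q` times the loss of
one query.

In the adaptive case the loss of a query is bounded by AM-GM with a free weight `α`, chosen at the
end to balance the two sides of `R` (`sum_overlap_sub_le`, `Algorithm.Solves.card_le`). In the
non-adaptive case the state before the only parallel query does not depend on the input. One input
`x` can therefore be fixed and only its neighbours averaged over, so that only one of the two loads
enters (`card_le_sum_overlap_parallelPhase`). -/

namespace PDQP

/-! ### Norms, overlaps and collapse branches of unnormalised states -/

section State

variable {S : Type} [Fintype S]

/-- The absolute value of the inner product of two states. -/
noncomputable def overlap (φ ψ : S → ℂ) : ℝ := ‖∑ s, star (φ s) * ψ s‖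

/-- The product of the norms of two states. -/
noncomputable def normMul (φ ψ : S → ℂ) : ℝ := √(normSq φ) * √(normSq ψ)

theorem normSq_nonneg (φ : S → ℂ) : 0 ≤ normSq φ :=
  sum_nonneg fun _ _ => sq_nonneg _

theorem overlap_le_sum (φ ψ : S → ℂ) : overlap φ ψ ≤ ∑ s, ‖φ s‖ * ‖ψ s‖ := by
  refine (norm_sum_le _ _).trans_eq (sum_congr rfl fun s _ => ?_)
  rw [norm_mul, norm_star]

theorem sum_norm_mul_norm_le (φ ψ : S → ℂ) : ∑ s, ‖φ s‖ * ‖ψ s‖ ≤ normMul φ ψ :=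
  Real.sum_mul_le_sqrt_mul_sqrt univ (fun s => ‖φ s‖) (fun s => ‖ψ s‖)

theorem overlap_le_normMul (φ ψ : S → ℂ) : overlap φ ψ ≤ normMul φ ψ :=
  (overlap_le_sum φ ψ).trans (sum_norm_mul_norm_le φ ψ)

theorem normMul_le_half_add (φ ψ : S → ℂ) :
    normMul φ ψ ≤ 1 / 2 * normSq φ + 1 / 2 * normSq ψ := by
  have h := two_mul_le_add_sq √(normSq φ) √(normSq ψ)
  rw [Real.sq_sqrt (normSq_nonneg φ), Real.sq_sqrt (normSq_nonneg ψ)] at h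
  unfold normMul
  linarith

theorem normSq_smul (r : ℝ) (φ : S → ℂ) : normSq (fun s => φ s / (r : ℂ)) = normSq φ / r ^ 2 := by
  simp [normSq, div_pow, sum_div]

theorem normSq_normalized_mul (φ : S → ℂ) : normSq φ * normSq (normalized φ) = normSq φ := by
  unfold normalized
  rw [normSq_smul, Real.sq_sqrt (normSq_nonneg φ)]
  by_cases h : normSq φ = 0
  · simp [h]
  · field_simp

theorem normalized_div (r : ℝ) (hr : 0 < r) (φ : S → ℂ) :
    normalized (fun s => φ s / (r : ℂ)) = normalized φ := by
  funext s
  have hr' : (r : ℂ) ≠ 0 := by exact_mod_cast hr.ne'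
  unfold normalized
  rw [normSq_smul, Real.sqrt_div (normSq_nonneg φ), Real.sqrt_sq hr.le]
  push_cast
  field_simp

theorem normalized_of_normSq_eq_one {φ : S → ℂ} (h : normSq φ = 1) : normalized φ = φ := by
  funext s
  simp [normalized, h]

/-- Multiplication of the amplitudes by phases. -/
noncomputable def phase (d : S → ℂ) (φ : S → ℂ) : S → ℂ := fun s => d s * φ s

theorem normSq_phase {d : S → ℂ} (hd : ∀ s, ‖d s‖ = 1) (φ : S → ℂ) :
    normSq (phase d φ) = normSq φ := by
  simp [normSq, phase, hd]

theorem phase_normalized {d : S → ℂ} (hd : ∀ s, ‖d s‖ = 1) (φ : S → ℂ) :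
    phase d (normalized φ) = normalized (phase d φ) := by
  funext s
  simp only [normalized, normSq_phase hd, phase, mul_div_assoc]

theorem ofReal_normSq (φ : S → ℂ) : ((normSq φ : ℝ) : ℂ) = ∑ s, star (φ s) * φ s := by
  simp only [normSq, Complex.ofReal_sum]
  refine sum_congr rfl fun s _ => ?_
  rw [mul_comm, Complex.star_def, Complex.mul_conj, Complex.normSq_eq_norm_sq]

theorem sum_ofFn_succ (N : ℕ) (F : List S → ℝ) :
    ∑ v : Fin (N + 1) → S, F (List.ofFn v) =
      ∑ v : S, ∑ u : Fin N → S, F (v :: List.ofFn u) := by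
  rw [← Fintype.sum_prod_type']
  refine (Fintype.sum_equiv (Fin.consEquiv fun _ : Fin (N + 1) => S) _ _ fun u => ?_).symm
  simp [Fin.consEquiv]

/-- The sum is the Bhattacharyya coefficient of one sample. Multiplying by the norms avoids
division, so that branches of probability zero need no exception. -/
theorem normMul_mul_sum_normalized (φ ψ : S → ℂ) :
    normMul φ ψ * ∑ v, ‖normalized φ v‖ * ‖normalized ψ v‖ = ∑ v, ‖φ v‖ * ‖ψ v‖ := by
  have key (φ : S → ℂ) (v : S) : √(normSq φ) * ‖normalized φ v‖ = ‖φ v‖ := by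
    simp only [normalized, norm_div, Complex.norm_real, Real.norm_eq_abs,
      abs_of_nonneg (Real.sqrt_nonneg _)]
    by_cases h : normSq φ = 0
    · have h' := (sum_eq_zero_iff_of_nonneg fun s _ => sq_nonneg ‖φ s‖).1 h v (mem_univ v)
      simp only [h, Real.sqrt_zero, zero_mul]
      exact (pow_eq_zero_iff two_ne_zero).1 h' |>.symm
    · have : √(normSq φ) ≠ 0 := (Real.sqrt_pos.2 ((normSq_nonneg φ).lt_of_ne' h)).ne'
      field_simp
  rw [mul_sum]
  refine sum_congr rfl fun v _ => ?_
  rw [← key φ v, ← key ψ v, normMul]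
  ring

theorem sum_normalized_le_one (φ ψ : S → ℂ) :
    ∑ v, ‖normalized φ v‖ * ‖normalized ψ v‖ ≤ 1 := by
  have key (φ : S → ℂ) : √(normSq (normalized φ)) ≤ 1 := by
    refine Real.sqrt_le_one.2 ?_
    unfold normalized
    rw [normSq_smul, Real.sq_sqrt (normSq_nonneg φ)]
    exact div_self_le_one _
  exact (sum_norm_mul_norm_le _ _).trans (mul_le_one₀ (key φ) (Real.sqrt_nonneg _) (key ψ))

variable [DecidableEq S]

theorem normSq_basisState (s : S) : normSq (basisState s) = 1 := by
  simp [normSq, basisState, Pi.single_apply, apply_ite norm]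

theorem sum_star_mul_mulVec (U : Matrix.unitaryGroup S ℂ) (φ ψ : S → ℂ) :
    ∑ s, star ((U : Matrix S S ℂ).mulVec φ s) * (U : Matrix S S ℂ).mulVec ψ s =
      ∑ s, star (φ s) * ψ s := by
  have h : (star ((U : Matrix S S ℂ).mulVec φ)) ⬝ᵥ ((U : Matrix S S ℂ).mulVec ψ) =
      star φ ⬝ᵥ ψ := by
    rw [Matrix.star_mulVec, ← Matrix.dotProduct_mulVec, Matrix.mulVec_mulVec,
      ← Matrix.star_eq_conjTranspose, Matrix.UnitaryGroup.star_mul_self, Matrix.one_mulVec]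
  exact h

theorem normSq_mulVec (U : Matrix.unitaryGroup S ℂ) (φ : S → ℂ) :
    normSq ((U : Matrix S S ℂ).mulVec φ) = normSq φ := by
  have h : ((normSq ((U : Matrix S S ℂ).mulVec φ) : ℝ) : ℂ) = (normSq φ : ℝ) := by
    rw [ofReal_normSq, ofReal_normSq, sum_star_mul_mulVec]
  exact_mod_cast h

/-- The unitary preserves the inner product, the projectors of the outcomes split it into a sum, and
the triangle inequality finishes. -/
theorem overlap_le_sum_branch (g : Gate S) (φ ψ : S → ℂ) :
    overlap φ ψ ≤ ∑ k, overlap (g.branch k φ) (g.branch k ψ) := by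
  have h : ∑ s, star (φ s) * ψ s =
      ∑ k, ∑ s, star (g.branch k φ s) * g.branch k ψ s := by
    rw [← sum_star_mul_mulVec g.U, sum_comm]
    refine sum_congr rfl fun s _ => ?_
    rw [sum_eq_single (g.label s)]
    · simp [Gate.branch]
    · intro k _ hk
      simp [Gate.branch, hk.symm]
    · simp
  unfold overlap
  rw [h]
  exact norm_sum_le _ _

theorem sum_normSq_branch (g : Gate S) (φ : S → ℂ) :
    ∑ k, normSq (g.branch k φ) = normSq φ := by
  rw [← normSq_mulVec g.U φ]
  unfold normSq
  rw [sum_comm]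
  refine sum_congr rfl fun s _ => ?_
  rw [sum_eq_single (g.label s)]
  · simp [Gate.branch]
  · intro k _ hk
    simp [Gate.branch, hk.symm]
  · simp

theorem sum_normMul_branch_le (g : Gate S) (φ ψ : S → ℂ) :
    ∑ k, normMul (g.branch k φ) (g.branch k ψ) ≤ normMul φ ψ := by
  have h := Real.sum_sqrt_mul_sqrt_le univ (fun k => normSq_nonneg (g.branch k φ))
    (fun k => normSq_nonneg (g.branch k ψ))
  rwa [sum_normSq_branch, sum_normSq_branch] at h

theorem branch_div (g : Gate S) (k : Fin g.outcomes) (r : ℝ) (φ : S → ℂ) :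
    g.branch k (fun s => φ s / (r : ℂ)) = fun s => g.branch k φ s / (r : ℂ) := by
  have h : (fun s => φ s / (r : ℂ)) = ((r : ℂ)⁻¹) • φ := by
    funext s
    simp [div_eq_inv_mul]
  funext s
  rw [h]
  simp only [Gate.branch, Matrix.mulVec_smul, Pi.smul_apply, smul_eq_mul]
  split_ifs <;> simp [div_eq_inv_mul]

theorem branch_eq_zero (g : Gate S) (k : Fin g.outcomes) {φ : S → ℂ} (h : normSq φ = 0) :
    normSq (g.branch k φ) = 0 := by
  rw [← sum_normSq_branch g φ] at h
  exact (sum_eq_zero_iff_of_nonneg fun k _ => normSq_nonneg _).1 h k (mem_univ k)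

theorem normSq_mul_normSq_branch_normalized (g : Gate S) (k : Fin g.outcomes) (φ : S → ℂ) :
    normSq φ * normSq (g.branch k (normalized φ)) = normSq (g.branch k φ) := by
  by_cases h : normSq φ = 0
  · rw [branch_eq_zero g k h, h, zero_mul]
  · unfold normalized
    rw [branch_div, normSq_smul, Real.sq_sqrt (normSq_nonneg φ)]
    field_simp

theorem normalized_branch_normalized (g : Gate S) (k : Fin g.outcomes) {φ : S → ℂ}
    (h : normSq φ ≠ 0) : normalized (g.branch k (normalized φ)) = normalized (g.branch k φ) := by
  have h0 : 0 < √(normSq φ) := Real.sqrt_pos.2 ((normSq_nonneg φ).lt_of_ne' h)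
  rw [show g.branch k (normalized φ) = fun s => g.branch k φ s / ((√(normSq φ) : ℝ) : ℂ) from
    branch_div g k _ φ, normalized_div _ h0]

end State

/-! ### Fidelity of the sample lists and its loss along a circuit -/

section Weight

variable {S : Type} [Fintype S] [DecidableEq S]

/-- `samplesProb`, extended to unnormalised states as a homogeneous function of degree `2`. -/
noncomputable def weight (d : S → ℂ) (C : List (Step S)) (φ : S → ℂ) (vs : List S) : ℝ :=
  normSq φ * samplesProb (phase d) C (normalized φ) vs

theorem samplesProb_nonneg (O : (S → ℂ) → (S → ℂ)) (C : List (Step S)) (φ : S → ℂ)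
    (vs : List S) : 0 ≤ samplesProb O C φ vs := by
  induction C generalizing φ vs with
  | nil => cases vs <;> simp [samplesProb]
  | cons s C ih =>
    obtain ⟨g, _ | _⟩ := s
    · exact sum_nonneg fun k _ => mul_nonneg (normSq_nonneg _) (ih _ _)
    · cases vs with
      | nil => simp [samplesProb]
      | cons v vs =>
        exact sum_nonneg fun k _ =>
          mul_nonneg (normSq_nonneg _) (mul_nonneg (sq_nonneg _) (ih _ _))

theorem weight_nonneg (d : S → ℂ) (C : List (Step S)) (φ : S → ℂ) (vs : List S) :
    0 ≤ weight d C φ vs :=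
  mul_nonneg (normSq_nonneg _) (samplesProb_nonneg _ _ _ _)

theorem weight_of_normSq_eq_one (d : S → ℂ) (C : List (Step S)) {φ : S → ℂ}
    (h : normSq φ = 1) (vs : List S) :
    weight d C φ vs = samplesProb (phase d) C φ vs := by
  rw [weight, h, one_mul, normalized_of_normSq_eq_one h]

/-- Homogeneity absorbs the branch probabilities into the norms, so the recursion runs over
unnormalised branches with no conditional probabilities left. -/
theorem weight_query {d : S → ℂ} (hd : ∀ s, ‖d s‖ = 1) (g : Gate S) (C : List (Step S))
    (φ : S → ℂ) (vs : List S) :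
    weight d (⟨g, .query⟩ :: C) φ vs = ∑ k, weight d C (phase d (g.branch k φ)) vs := by
  simp only [weight, samplesProb, mul_sum]
  refine sum_congr rfl fun k _ => ?_
  rw [← mul_assoc, normSq_mul_normSq_branch_normalized, normSq_phase hd, phase_normalized hd]
  by_cases h : normSq φ = 0
  · simp [branch_eq_zero g k h]
  · rw [← phase_normalized hd, normalized_branch_normalized g k h, phase_normalized hd]

theorem weight_sample (d : S → ℂ) (g : Gate S) (C : List (Step S)) (φ : S → ℂ) (v : S)
    (vs : List S) :
    weight d (⟨g, .sample⟩ :: C) φ (v :: vs) =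
      ∑ k, ‖normalized (g.branch k φ) v‖ ^ 2 * weight d C (g.branch k φ) vs := by
  simp only [weight, samplesProb, mul_sum]
  refine sum_congr rfl fun k _ => ?_
  rw [← mul_assoc, normSq_mul_normSq_branch_normalized]
  by_cases h : normSq φ = 0
  · simp [branch_eq_zero g k h]
  · rw [normalized_branch_normalized g k h]
    ring

theorem numSamples_query (g : Gate S) (C : List (Step S)) :
    numSamples (⟨g, .query⟩ :: C) = numSamples C := by
  simp [numSamples, Step.isQuery]

theorem numSamples_sample (g : Gate S) (C : List (Step S)) :
    numSamples (⟨g, .sample⟩ :: C) = numSamples C + 1 := by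
  simp [numSamples, Step.isQuery]

theorem numQueries_query (g : Gate S) (C : List (Step S)) :
    numQueries (⟨g, .query⟩ :: C) = numQueries C + 1 := by
  simp [numQueries, Step.isQuery]

theorem numQueries_sample (g : Gate S) (C : List (Step S)) :
    numQueries (⟨g, .sample⟩ :: C) = numQueries C := by
  simp [numQueries, Step.isQuery]

theorem sum_weight {d : S → ℂ} (hd : ∀ s, ‖d s‖ = 1) (C : List (Step S)) (N : ℕ)
    (hN : numSamples C = N) (φ : S → ℂ) :
    ∑ v : Fin N → S, weight d C φ (List.ofFn v) = normSq φ := by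
  induction C generalizing φ N with
  | nil =>
    obtain rfl : N = 0 := by simpa [numSamples] using hN.symm
    simp [weight, samplesProb]
  | cons s C ih =>
    obtain ⟨g, _ | _⟩ := s
    · rw [numSamples_query] at hN
      simp only [weight_query hd]
      rw [sum_comm]
      simp only [ih N hN, normSq_phase hd, sum_normSq_branch]
    · rw [numSamples_sample] at hN
      subst hN
      rw [sum_ofFn_succ]
      simp only [weight_sample]
      have h (v : S) : ∑ u : Fin (numSamples C) → S, ∑ k,
          ‖normalized (g.branch k φ) v‖ ^ 2 * weight d C (g.branch k φ) (List.ofFn u) =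
          ∑ k, ‖normalized (g.branch k φ) v‖ ^ 2 * normSq (g.branch k φ) := by
        rw [sum_comm]
        simp only [← mul_sum, ih _ rfl]
      simp only [h]
      rw [sum_comm, ← sum_normSq_branch g φ]
      refine sum_congr rfl fun k _ => ?_
      rw [← sum_mul, mul_comm]
      exact normSq_normalized_mul _

/-- The Bhattacharyya coefficient of the weights of the results of `N` non-collapsing
measurements. -/
noncomputable def fid (d e : S → ℂ) (C : List (Step S)) (N : ℕ) (φ ψ : S → ℂ) : ℝ :=
  ∑ v : Fin N → S, √(weight d C φ (List.ofFn v)) * √(weight e C ψ (List.ofFn v))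

theorem fid_le_normMul {d e : S → ℂ} (hd : ∀ s, ‖d s‖ = 1) (he : ∀ s, ‖e s‖ = 1)
    (C : List (Step S)) (N : ℕ) (hN : numSamples C = N) (φ ψ : S → ℂ) :
    fid d e C N φ ψ ≤ normMul φ ψ := by
  have h := Real.sum_sqrt_mul_sqrt_le univ
    (fun v : Fin N → S => weight_nonneg d C φ (List.ofFn v))
    (fun v : Fin N → S => weight_nonneg e C ψ (List.ofFn v))
  rwa [sum_weight hd C N hN, sum_weight he C N hN] at h

/-- The outcome of the collapse is not part of the output. Forgetting it can only raise the
fidelity, by Cauchy-Schwarz over the outcomes. -/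
theorem sum_fid_le_fid_query {d e : S → ℂ} (hd : ∀ s, ‖d s‖ = 1) (he : ∀ s, ‖e s‖ = 1)
    (g : Gate S) (C : List (Step S)) (N : ℕ) (φ ψ : S → ℂ) :
    ∑ k, fid d e C N (phase d (g.branch k φ)) (phase e (g.branch k ψ)) ≤
      fid d e (⟨g, .query⟩ :: C) N φ ψ := by
  unfold fid
  rw [sum_comm]
  refine sum_le_sum fun v _ => ?_
  rw [weight_query hd, weight_query he]
  exact Real.sum_sqrt_mul_sqrt_le univ (fun k => weight_nonneg _ _ _ _)
    (fun k => weight_nonneg _ _ _ _)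

theorem sum_mul_fid_le_fid_sample (d e : S → ℂ) (g : Gate S) (C : List (Step S)) (N : ℕ)
    (φ ψ : S → ℂ) :
    ∑ k, (∑ v, ‖normalized (g.branch k φ) v‖ * ‖normalized (g.branch k ψ) v‖) *
        fid d e C N (g.branch k φ) (g.branch k ψ) ≤
      fid d e (⟨g, .sample⟩ :: C) (N + 1) φ ψ := by
  unfold fid
  rw [sum_ofFn_succ N fun l => √(weight d (⟨g, .sample⟩ :: C) φ l) *
    √(weight e (⟨g, .sample⟩ :: C) ψ l)]
  simp only [sum_mul_sum]
  rw [sum_comm]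
  refine sum_le_sum fun v _ => ?_
  rw [sum_comm]
  refine sum_le_sum fun u _ => ?_
  rw [weight_sample, weight_sample]
  refine le_trans (sum_le_sum fun k _ => ?_) (Real.sum_sqrt_mul_sqrt_le univ
    (fun k => mul_nonneg (sq_nonneg _) (weight_nonneg _ _ _ _))
    (fun k => mul_nonneg (sq_nonneg _) (weight_nonneg _ _ _ _)))
  rw [Real.sqrt_mul (sq_nonneg _), Real.sqrt_mul (sq_nonneg _), Real.sqrt_sq (norm_nonneg _),
    Real.sqrt_sq (norm_nonneg _)]
  exact le_of_eq (by ring)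

/-- A sample multiplies the fidelity of a branch by some `c ≤ 1`. As that fidelity is at most the
norm product, the loss is at most `1 - c` times the norm product, and `c` times the norm product is
at least the overlap. This turns a multiplicative loss into an additive one. -/
theorem sum_fid_sub_le_fid_sample {d e : S → ℂ} (hd : ∀ s, ‖d s‖ = 1) (he : ∀ s, ‖e s‖ = 1)
    (g : Gate S) (C : List (Step S)) (N : ℕ) (hN : numSamples C = N) (φ ψ : S → ℂ) :
    ∑ k, (fid d e C N (g.branch k φ) (g.branch k ψ) -
        (normMul (g.branch k φ) (g.branch k ψ) - overlap (g.branch k φ) (g.branch k ψ))) ≤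
      fid d e (⟨g, .sample⟩ :: C) (N + 1) φ ψ := by
  refine le_trans (sum_le_sum fun k _ => ?_) (sum_mul_fid_le_fid_sample d e g C N φ ψ)
  have h1 := fid_le_normMul hd he C N hN (g.branch k φ) (g.branch k ψ)
  have h2 := normMul_mul_sum_normalized (g.branch k φ) (g.branch k ψ)
  have h3 := sum_normalized_le_one (g.branch k φ) (g.branch k ψ)
  have h4 := overlap_le_sum (g.branch k φ) (g.branch k ψ)
  have h5 := mul_le_mul_of_nonneg_right h1 (sub_nonneg.2 h3)
  linarith

/-- If a query lowers the total overlap over `R` by at most a quadratic form in the norms, then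
the total fidelity of the results is bounded below in terms of the number of queries and samples. -/
theorem le_sum_fid {I : Type} (d : I → S → ℂ) (hd : ∀ i s, ‖d i s‖ = 1) (R : Finset (I × I))
    (X Y : Finset I) (a b : ℝ) (ha : 0 ≤ a) (hb : 0 ≤ b)
    (hV : ∀ φ : I → S → ℂ, ∑ p ∈ R, overlap (φ p.1) (φ p.2) -
        (a * ∑ x ∈ X, normSq (φ x) + b * ∑ y ∈ Y, normSq (φ y)) ≤
      ∑ p ∈ R, overlap (phase (d p.1) (φ p.1)) (phase (d p.2) (φ p.2)))
    (C : List (Step S)) (N : ℕ) (hN : numSamples C = N) (φ : I → S → ℂ) :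
    (N + 1) * ∑ p ∈ R, overlap (φ p.1) (φ p.2) - N * ∑ p ∈ R, normMul (φ p.1) (φ p.2) -
        (N + 1) * numQueries C *
          (a * ∑ x ∈ X, normSq (φ x) + b * ∑ y ∈ Y, normSq (φ y)) ≤
      ∑ p ∈ R, fid (d p.1) (d p.2) C N (φ p.1) (φ p.2) := by
  -- The squared norms are conserved when summed over branches, so the cost of a query is the same
  -- wherever it stands in the circuit.
  have hsq (g : Gate S) (Z : Finset I) (φ : I → S → ℂ) :
      ∑ k, ∑ x ∈ Z, normSq (g.branch k (φ x)) = ∑ x ∈ Z, normSq (φ x) := by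
    rw [sum_comm]
    exact sum_congr rfl fun x _ => sum_normSq_branch g (φ x)
  have hov (g : Gate S) (φ : I → S → ℂ) : ∑ p ∈ R, overlap (φ p.1) (φ p.2) ≤
      ∑ k, ∑ p ∈ R, overlap (g.branch k (φ p.1)) (g.branch k (φ p.2)) := by
    rw [sum_comm]
    exact sum_le_sum fun p _ => overlap_le_sum_branch g _ _
  have hnm (g : Gate S) (φ : I → S → ℂ) :
      ∑ k, ∑ p ∈ R, normMul (g.branch k (φ p.1)) (g.branch k (φ p.2)) ≤
      ∑ p ∈ R, normMul (φ p.1) (φ p.2) := by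
    rw [sum_comm]
    exact sum_le_sum fun p _ => sum_normMul_branch_le g _ _
  induction C generalizing φ N with
  | nil =>
    obtain rfl : N = 0 := by simpa [numSamples] using hN.symm
    simp only [numQueries, List.countP_nil]
    have h : ∑ p ∈ R, fid (d p.1) (d p.2) [] 0 (φ p.1) (φ p.2) =
        ∑ p ∈ R, normMul (φ p.1) (φ p.2) :=
      sum_congr rfl fun p _ => by simp [fid, weight, samplesProb, normMul]
    rw [h]
    have := sum_le_sum fun p (_ : p ∈ R) => overlap_le_normMul (φ p.1) (φ p.2)
    simpa using this
  | cons s C ih =>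
    obtain ⟨g, _ | _⟩ := s
    · rw [numSamples_query] at hN
      rw [numQueries_query]
      have h1 := sum_le_sum fun k (_ : k ∈ (univ : Finset (Fin g.outcomes))) =>
        ih N hN fun i => phase (d i) (g.branch k (φ i))
      have h2 := sum_le_sum fun k (_ : k ∈ (univ : Finset (Fin g.outcomes))) =>
        hV fun i => g.branch k (φ i)
      have h3 := sum_le_sum fun p (_ : p ∈ R) =>
        sum_fid_le_fid_query (hd p.1) (hd p.2) g C N (φ p.1) (φ p.2)
      rw [sum_comm] at h3
      simp only [normMul, normSq_phase (hd _), sum_sub_distrib, sum_add_distrib, ← mul_sum,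
        hsq] at h1 h2
      have h4 := hov g φ
      have h5 := hnm g φ
      simp only [normMul] at h5 ⊢
      refine le_trans ?_ (h1.trans h3)
      have h6 := mul_le_mul_of_nonneg_left (h4.trans (sub_le_iff_le_add.1 h2))
        (by positivity : (0 : ℝ) ≤ N + 1)
      have h7 := mul_le_mul_of_nonneg_left h5 (Nat.cast_nonneg (α := ℝ) N)
      push_cast
      linarith
    · rw [numSamples_sample] at hN
      subst hN
      rw [numQueries_sample]
      have h1 := sum_le_sum fun k (_ : k ∈ (univ : Finset (Fin g.outcomes))) =>
        ih _ rfl fun i => g.branch k (φ i)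
      have h3 := sum_le_sum fun p (_ : p ∈ R) =>
        sum_fid_sub_le_fid_sample (hd p.1) (hd p.2) g C _ rfl (φ p.1) (φ p.2)
      rw [sum_comm] at h3
      simp only [sum_sub_distrib, sum_add_distrib, ← mul_sum, hsq] at h1 h3
      have h4 := hov g φ
      have h5 := hnm g φ
      refine le_trans ?_ h3
      have h6 := mul_le_mul_of_nonneg_left h4
        (by positivity : (0 : ℝ) ≤ numSamples C + 2)
      have h7 := mul_le_mul_of_nonneg_left h5
        (by positivity : (0 : ℝ) ≤ numSamples C + 1)
      -- The induction hypothesis charges the queries with the factor `numSamples C + 1`, the goal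
      -- with `numSamples C + 2`; the surplus is nonnegative.
      have h8 : 0 ≤ numQueries C *
          (a * ∑ x ∈ X, normSq (φ x) + b * ∑ y ∈ Y, normSq (φ y)) := by
        have hs (Z : Finset I) : 0 ≤ ∑ x ∈ Z, normSq (φ x) :=
          sum_nonneg fun _ _ => normSq_nonneg _
        have := mul_nonneg ha (hs X)
        have := mul_nonneg hb (hs Y)
        positivity
      push_cast
      linarith

end Weight

/-- Two distributions that are told apart by an event have small Bhattacharyya coefficient. -/
theorem sum_sqrt_mul_sqrt_le_of_distinguish {T : Type} [Fintype T] (p q : T → ℝ)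
    (hp : ∀ t, 0 ≤ p t) (hq : ∀ t, 0 ≤ q t) (hp1 : ∑ t, p t = 1) (hq1 : ∑ t, q t = 1)
    (E : T → Bool) (ε : ℝ) (hε : ε < 1 / 2)
    (hpE : 1 - ε ≤ ∑ t, if E t = true then p t else 0)
    (hqE : 1 - ε ≤ ∑ t, if E t = false then q t else 0) :
    ∑ t, √(p t) * √(q t) ≤ 1 - (1 - 2 * ε) ^ 2 / 2 := by
  have split (r : T → ℝ) : ∑ t, r t =
      (∑ t with E t = true, r t) + ∑ t with E t = false, r t := by
    rw [← sum_filter_add_sum_filter_not univ (fun t => E t = true) r]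
    simp
  rw [← sum_filter] at hpE hqE
  rw [split] at hp1 hq1 ⊢
  have cs (F : Finset T) := Real.sum_sqrt_mul_sqrt_le F hp hq
  have nn (F : Finset T) (r : T → ℝ) (h : ∀ t, 0 ≤ r t) : 0 ≤ ∑ t ∈ F, r t :=
    sum_nonneg fun t _ => h t
  have c1 := cs {t | E t = true}
  have c2 := cs {t | E t = false}
  have n1 := nn {t | E t = true} p hp
  have n2 := nn {t | E t = false} p hp
  have n3 := nn {t | E t = true} q hq
  have n4 := nn {t | E t = false} q hq
  generalize (∑ t with E t = true, p t) = a at *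
  generalize (∑ t with E t = false, p t) = b at *
  generalize (∑ t with E t = true, q t) = c at *
  generalize (∑ t with E t = false, q t) = d at *
  refine (add_le_add c1 c2).trans ?_
  -- With `b = 1 - a` and `d = 1 - c`, the bound `a * c + b * d + a * b + c * d` equals `1 - (a - c)
  -- ^ 2`, and `a - c ≥ 1 - 2 * ε`.
  have hsq : (√a * √c + √b * √d) ^ 2 ≤ 1 - (1 - 2 * ε) ^ 2 := by
    have e1 := Real.sq_sqrt n1
    have e2 := Real.sq_sqrt n2
    have e3 := Real.sq_sqrt n3
    have e4 := Real.sq_sqrt n4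
    have h1 : (√a * √c + √b * √d) ^ 2 ≤ a * c + b * d + (a * b + c * d) := by
      have := sq_nonneg (√a * √b - √c * √d)
      calc _ = √a ^ 2 * √c ^ 2 + √b ^ 2 * √d ^ 2 + 2 * (√a * √b) * (√c * √d) := by ring
        _ ≤ √a ^ 2 * √c ^ 2 + √b ^ 2 * √d ^ 2 + (√a ^ 2 * √b ^ 2 + √c ^ 2 * √d ^ 2) := by
          linarith
        _ = _ := by rw [e1, e2, e3, e4]
    obtain rfl : b = 1 - a := by linarith
    obtain rfl : d = 1 - c := by linarith
    have h2 : (1 - 2 * ε) ^ 2 ≤ (a - c) ^ 2 := by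
      apply pow_le_pow_left₀ <;> linarith
    linarith
  have := two_mul_le_add_sq (√a * √c + √b * √d) 1
  linarith

/-! ### Loss of overlap under a change of phases, and counting over fibres -/

section Loss

variable {S : Type} [Fintype S]

-- Basis states on which the phases agree contribute the same to both inner products. On the others
-- the relative phase differs from `1` by at most `2`.
open Classical in
theorem overlap_sub_le_overlap_phase {d e : S → ℂ} (hd : ∀ s, ‖d s‖ = 1) (he : ∀ s, ‖e s‖ = 1)
    (φ ψ : S → ℂ) :
    overlap φ ψ - ∑ s, (if d s ≠ e s then 2 * (‖φ s‖ * ‖ψ s‖) else 0) ≤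
      overlap (phase d φ) (phase e ψ) := by
  rw [sub_le_comm]
  unfold overlap
  refine (norm_sub_norm_le _ _).trans ?_
  rw [← sum_sub_distrib]
  refine (norm_sum_le _ _).trans (sum_le_sum fun s _ => ?_)
  have h : star (φ s) * ψ s - star (phase d φ s) * phase e ψ s =
      (1 - star (d s) * e s) * (star (φ s) * ψ s) := by
    simp only [phase, star_mul']
    ring
  rw [h, norm_mul, norm_mul, norm_star]
  split_ifs with hs
  · refine mul_le_mul_of_nonneg_right ((norm_sub_le _ _).trans ?_) (by positivity)
    rw [norm_mul, norm_star, hd, he]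
    norm_num
  · have h1 : star (d s) * e s = 1 := by
      rw [← not_not.1 hs, mul_comm, Complex.star_def, Complex.mul_conj, Complex.normSq_eq_norm_sq,
        hd]
      norm_num
    rw [h1, sub_self, norm_zero, zero_mul]

/-- Counting over the fibres of `π`, if each `s` is in relation to at most `L` elements of a
fibre. -/
theorem sum_sum_ite_le {P I : Type} [DecidableEq I] (R : Finset P) (Z : Finset I) (π : P → I)
    (hπ : ∀ p ∈ R, π p ∈ Z) (D : P → S → Prop) [∀ p s, Decidable (D p s)] (L : ℕ)
    (hL : ∀ z ∈ Z, ∀ s, #{p ∈ R | π p = z ∧ D p s} ≤ L) (c : I → S → ℝ)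
    (hc : ∀ z s, 0 ≤ c z s) :
    ∑ p ∈ R, ∑ s, (if D p s then c (π p) s else 0) ≤ L * ∑ z ∈ Z, ∑ s, c z s := by
  rw [← sum_fiberwise_of_maps_to hπ, mul_sum]
  refine sum_le_sum fun z hz => ?_
  rw [sum_comm, mul_sum]
  refine sum_le_sum fun s _ => ?_
  have h : ∑ p ∈ R with π p = z, (if D p s then c (π p) s else 0) =
      #{p ∈ R | π p = z ∧ D p s} * c z s := by
    rw [← sum_filter, filter_filter, ← nsmul_eq_mul]
    refine sum_eq_card_nsmul fun p hp => ?_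
    rw [(mem_filter.1 hp).2.1]
  rw [h]
  exact mul_le_mul_of_nonneg_right (by exact_mod_cast hL z hz s) (hc z s)

/-- Without samples the output is the constant `post []`, so one of the two sums is zero. Having a
sample allows `N + 1` to be replaced by `2 * N` later. -/
theorem pos_of_distinguish (N : ℕ) (post : List S → Bool) (p q : List S → ℝ) (ε : ℝ)
    (hε : ε < 1 / 2)
    (h1 : 1 - ε ≤ ∑ v : Fin N → S, if post (List.ofFn v) = true then p (List.ofFn v) else 0)
    (h2 : 1 - ε ≤ ∑ v : Fin N → S, if post (List.ofFn v) = false then q (List.ofFn v) else 0) :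
    1 ≤ N := by
  by_contra h
  obtain rfl : N = 0 := by omega
  cases hb : post [] <;> simp [hb] at h1 h2 <;> linarith

end Loss

section Distinguish

variable {S : Type} [Fintype S] [DecidableEq S]

theorem fid_le_of_distinguish {d e : S → ℂ} (hd : ∀ s, ‖d s‖ = 1) (he : ∀ s, ‖e s‖ = 1)
    (C : List (Step S)) (N : ℕ) (hN : numSamples C = N) {φ ψ : S → ℂ} (hφ : normSq φ = 1)
    (hψ : normSq ψ = 1) (post : List S → Bool) (ε : ℝ) (hε : ε < 1 / 2)
    (h1 : 1 - ε ≤ ∑ v : Fin N → S, if post (List.ofFn v) = true then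
      samplesProb (phase d) C φ (List.ofFn v) else 0)
    (h2 : 1 - ε ≤ ∑ v : Fin N → S, if post (List.ofFn v) = false then
      samplesProb (phase e) C ψ (List.ofFn v) else 0) :
    fid d e C N φ ψ ≤ 1 - (1 - 2 * ε) ^ 2 / 2 := by
  simp only [← weight_of_normSq_eq_one d C hφ, ← weight_of_normSq_eq_one e C hψ] at h1 h2
  exact sum_sqrt_mul_sqrt_le_of_distinguish _ _ (fun v => weight_nonneg _ _ _ _)
    (fun v => weight_nonneg _ _ _ _) ((sum_weight hd C N hN φ).trans hφ)
    ((sum_weight he C N hN ψ).trans hψ) (fun v => post (List.ofFn v)) ε hε h1 h2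

end Distinguish

/-! ### Degrees and loads of the relation -/

section Parameters

variable {n : ℕ} {X Y : Finset (Fin n → Bool)} (R : Finset ((Fin n → Bool) × (Fin n → Bool)))

theorem card_filter_le_loadX {x : Fin n → Bool} (hx : x ∈ X) (i : Fin n) :
    #{p ∈ R | p.1 = x ∧ p.1 i ≠ p.2 i} ≤ loadX X R := by
  refine le_sup_of_le hx ?_
  exact le_sup_of_le (mem_univ i) le_rfl

theorem card_filter_le_loadY {y : Fin n → Bool} (hy : y ∈ Y) (i : Fin n) :
    #{p ∈ R | p.2 = y ∧ p.1 i ≠ p.2 i} ≤ loadY Y R := by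
  refine le_sup_of_le hy ?_
  exact le_sup_of_le (mem_univ i) le_rfl

theorem degX_le (hX : X.Nonempty) {x : Fin n → Bool} (hx : x ∈ X) :
    degX X hX R ≤ #{p ∈ R | p.1 = x} :=
  inf'_le_of_le _ hx le_rfl

theorem degY_le (hY : Y.Nonempty) {y : Fin n → Bool} (hy : y ∈ Y) :
    degY Y hY R ≤ #{p ∈ R | p.2 = y} :=
  inf'_le_of_le _ hy le_rfl

variable {R}

theorem card_mul_degX_le (hX : X.Nonempty) (hR : R ⊆ X ×ˢ Y) : #X * degX X hX R ≤ #R := by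
  have h : (R : Set _).MapsTo Prod.fst (X : Set (Fin n → Bool)) := fun p hp => (mem_product.1 (hR hp)).1
  rw [card_eq_sum_card_fiberwise h, ← smul_eq_mul]
  exact card_nsmul_le_sum _ _ _ fun x hx => degX_le R hX hx

theorem card_mul_degY_le (hY : Y.Nonempty) (hR : R ⊆ X ×ˢ Y) : #Y * degY Y hY R ≤ #R := by
  have h : (R : Set _).MapsTo Prod.snd (Y : Set (Fin n → Bool)) := fun p hp => (mem_product.1 (hR hp)).2
  rw [card_eq_sum_card_fiberwise h, ← smul_eq_mul]
  exact card_nsmul_le_sum _ _ _ fun y hy => degY_le R hY hy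

end Parameters

/-! ### The bound for adaptive queries -/

section Adaptive

variable {n : ℕ}

/-- The phases of the oracle `phaseOracle`. -/
noncomputable def oraclePhase {w : ℕ} (x : Fin n → Bool) (s : Basis n w) : ℂ :=
  (-1) ^ ((x s.1).toNat * s.2.1.toNat)

theorem norm_oraclePhase {w : ℕ} (x : Fin n → Bool) (s : Basis n w) : ‖oraclePhase x s‖ = 1 := by
  simp [oraclePhase]

/-- The loss of total overlap over `R` in one query. -/
theorem sum_overlap_sub_le {w : ℕ} (X Y : Finset (Fin n → Bool))
    (R : Finset ((Fin n → Bool) × (Fin n → Bool))) (hR : R ⊆ X ×ˢ Y) (α : ℝ) (hα : 0 < α)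
    (φ : (Fin n → Bool) → Basis n w → ℂ) :
    ∑ p ∈ R, overlap (φ p.1) (φ p.2) - (α * loadX X R * ∑ x ∈ X, normSq (φ x) +
        α⁻¹ * loadY Y R * ∑ y ∈ Y, normSq (φ y)) ≤
      ∑ p ∈ R, overlap (phase (oraclePhase p.1) (φ p.1)) (phase (oraclePhase p.2) (φ p.2)) := by
  classical
  have hX : ∑ p ∈ R, ∑ s, (if p.1 s.1 ≠ p.2 s.1 then ‖φ p.1 s‖ ^ 2 else 0) ≤
      loadX X R * ∑ x ∈ X, normSq (φ x) := by
    refine sum_sum_ite_le R X Prod.fst (fun p hp => (mem_product.1 (hR hp)).1)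
      (fun p s => p.1 s.1 ≠ p.2 s.1) _ (fun x hx s => ?_) (fun x s => ‖φ x s‖ ^ 2)
      fun _ _ => sq_nonneg _
    exact card_filter_le_loadX R hx s.1
  have hY : ∑ p ∈ R, ∑ s, (if p.1 s.1 ≠ p.2 s.1 then ‖φ p.2 s‖ ^ 2 else 0) ≤
      loadY Y R * ∑ y ∈ Y, normSq (φ y) := by
    refine sum_sum_ite_le R Y Prod.snd (fun p hp => (mem_product.1 (hR hp)).2)
      (fun p s => p.1 s.1 ≠ p.2 s.1) _ (fun x hx s => ?_) (fun x s => ‖φ x s‖ ^ 2)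
      fun _ _ => sq_nonneg _
    exact card_filter_le_loadY R hx s.1
  have hpt : ∑ p ∈ R, ∑ s, (if oraclePhase p.1 s ≠ oraclePhase p.2 s then
      2 * (‖φ p.1 s‖ * ‖φ p.2 s‖) else 0) ≤
      α * (∑ p ∈ R, ∑ s, if p.1 s.1 ≠ p.2 s.1 then ‖φ p.1 s‖ ^ 2 else 0) +
      α⁻¹ * ∑ p ∈ R, ∑ s, if p.1 s.1 ≠ p.2 s.1 then ‖φ p.2 s‖ ^ 2 else 0 := by
    simp only [mul_sum, ← sum_add_distrib]
    refine sum_le_sum fun p _ => sum_le_sum fun s _ => ?_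
    by_cases h : p.1 s.1 = p.2 s.1
    · simp [oraclePhase, h]
    · have amgm : 2 * (‖φ p.1 s‖ * ‖φ p.2 s‖) ≤
          α * ‖φ p.1 s‖ ^ 2 + α⁻¹ * ‖φ p.2 s‖ ^ 2 := by
        have := mul_nonneg (inv_nonneg.2 hα.le) (sq_nonneg (α * ‖φ p.1 s‖ - ‖φ p.2 s‖))
        have e : α⁻¹ * (α * ‖φ p.1 s‖ - ‖φ p.2 s‖) ^ 2 = α * ‖φ p.1 s‖ ^ 2 +
            α⁻¹ * ‖φ p.2 s‖ ^ 2 - 2 * (‖φ p.1 s‖ * ‖φ p.2 s‖) := by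
          field_simp
          ring
        linarith
      simp only [ne_eq, h, not_false_eq_true, if_true]
      -- For `b = 0` the phases agree although the input bits differ; then the left side is `0`.
      split_ifs
      · positivity
      · exact amgm
  have hl := sum_le_sum fun p (_ : p ∈ R) => overlap_sub_le_overlap_phase
    (norm_oraclePhase (w := w) p.1) (norm_oraclePhase p.2) (φ p.1) (φ p.2)
  rw [sum_sub_distrib] at hl
  have := mul_le_mul_of_nonneg_left hX hα.le
  have := mul_le_mul_of_nonneg_left hY (inv_nonneg.2 hα.le)
  linarith

theorem Algorithm.Solves.one_le_P {f : (Fin n → Bool) → Bool} {ε : ℝ} (hε : ε < 1 / 2)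
    {A : Algorithm n} (hA : A.Solves f ε) {x y : Fin n → Bool} (hx : f x = true)
    (hy : f y = false) : 1 ≤ A.P := by
  have h1 := hA x
  have h2 := hA y
  rw [hx] at h1
  rw [hy] at h2
  exact pos_of_distinguish A.P A.post
    (samplesProb (phaseOracle x) A.circuit (basisState A.init))
    (samplesProb (phaseOracle y) A.circuit (basisState A.init)) ε hε h1 h2

theorem Algorithm.Solves.fid_le {f : (Fin n → Bool) → Bool} {ε : ℝ} (hε : ε < 1 / 2)
    {A : Algorithm n} (hA : A.Solves f ε) {x y : Fin n → Bool} (hx : f x = true)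
    (hy : f y = false) :
    fid (oraclePhase x) (oraclePhase y) A.circuit A.P (basisState A.init) (basisState A.init) ≤
      1 - (1 - 2 * ε) ^ 2 / 2 := by
  have h1 := hA x
  have h2 := hA y
  rw [hx] at h1
  rw [hy] at h2
  exact fid_le_of_distinguish (norm_oraclePhase x) (norm_oraclePhase y) A.circuit A.P rfl
    (normSq_basisState A.init) (normSq_basisState A.init) A.post ε hε h1 h2

/-- The adversary inequality before the choice of the balancing parameter `α`. -/
theorem Algorithm.Solves.card_le {f : (Fin n → Bool) → Bool} {ε : ℝ} (hε : ε < 1 / 2)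
    {A : Algorithm n} (hA : A.Solves f ε) {X Y : Finset (Fin n → Bool)}
    {R : Finset ((Fin n → Bool) × (Fin n → Bool))} (hfX : ∀ x ∈ X, f x = true)
    (hfY : ∀ y ∈ Y, f y = false) (hR : R ⊆ X ×ˢ Y) (hne : R.Nonempty) {α : ℝ} (hα : 0 < α) :
    (1 - 2 * ε) ^ 2 / 4 * #R ≤
      A.Q * A.P * (α * loadX X R * #X + α⁻¹ * loadY Y R * #Y) := by
  have hf (p) (hp : p ∈ R) : f p.1 = true ∧ f p.2 = false :=
    ⟨hfX _ (mem_product.1 (hR hp)).1, hfY _ (mem_product.1 (hR hp)).2⟩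
  have hP : 1 ≤ A.P := by
    obtain ⟨p, hp⟩ := hne
    exact hA.one_le_P hε (hf p hp).1 (hf p hp).2
  have hmain := le_sum_fid (fun x => oraclePhase (w := A.w) x) (fun x => norm_oraclePhase x) R X Y
    (α * loadX X R) (α⁻¹ * loadY Y R) (by positivity) (by positivity)
    (sum_overlap_sub_le X Y R hR α hα) A.circuit A.P rfl (fun _ => basisState A.init)
  have hfid := sum_le_sum fun p hp => hA.fid_le hε (hf p hp).1 (hf p hp).2
  have hov : overlap (basisState A.init) (basisState A.init) = 1 := by
    rw [overlap, ← ofReal_normSq, normSq_basisState]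
    simp
  have hnm : normMul (basisState A.init) (basisState A.init) = 1 := by
    simp [normMul, normSq_basisState]
  simp only [hov, hnm, normSq_basisState, sum_const, nsmul_eq_mul, mul_one] at hmain hfid
  have h0 : (0 : ℝ) ≤ A.Q * (α * loadX X R * #X + α⁻¹ * loadY Y R * #Y) := by positivity
  have hP' : (A.P : ℝ) + 1 ≤ 2 * A.P := by
    have : (1 : ℝ) ≤ A.P := by exact_mod_cast hP
    linarith
  have h1 := mul_le_mul_of_nonneg_right hP' h0
  rw [show numQueries A.circuit = A.Q from rfl] at hmain
  linarith

theorem Algorithm.Solves.sqrt_le {f : (Fin n → Bool) → Bool} {ε : ℝ} (hε : ε < 1 / 2)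
    {A : Algorithm n} (hA : A.Solves f ε) {X Y : Finset (Fin n → Bool)} (hX : X.Nonempty)
    (hY : Y.Nonempty) {R : Finset ((Fin n → Bool) × (Fin n → Bool))}
    (hfX : ∀ x ∈ X, f x = true) (hfY : ∀ y ∈ Y, f y = false) (hR : R ⊆ X ×ˢ Y) :
    (1 - 2 * ε) ^ 2 / 8 * √(((degX X hX R : ℝ) * (degY Y hY R : ℝ)) /
      ((loadX X R : ℝ) * (loadY Y R : ℝ))) ≤ A.Q * A.P := by
  have hmX := card_mul_degX_le hX hR
  have hmY := card_mul_degY_le hY hR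
  -- This also covers zero loads, where the quotient is `0` by convention.
  by_cases hz : ((degX X hX R : ℝ) * (degY Y hY R : ℝ)) /
      ((loadX X R : ℝ) * (loadY Y R : ℝ)) = 0
  · rw [hz]
    simp only [Real.sqrt_zero, mul_zero]
    positivity
  simp only [div_eq_zero_iff, mul_eq_zero, Nat.cast_eq_zero, not_or] at hz
  obtain ⟨⟨h1, h2⟩, h3, h4⟩ := hz
  have hne : R.Nonempty := by
    rw [← card_pos]
    exact lt_of_lt_of_le (Nat.mul_pos hX.card_pos (Nat.pos_of_ne_zero h1)) hmX
  have m0 : (0 : ℝ) < degX X hX R := by exact_mod_cast Nat.pos_of_ne_zero h1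
  have m0' : (0 : ℝ) < degY Y hY R := by exact_mod_cast Nat.pos_of_ne_zero h2
  have l0 : (0 : ℝ) < loadX X R := by exact_mod_cast Nat.pos_of_ne_zero h3
  have l0' : (0 : ℝ) < loadY Y R := by exact_mod_cast Nat.pos_of_ne_zero h4
  have r0 : (0 : ℝ) < #R := by exact_mod_cast hne.card_pos
  have hcX : (#X : ℝ) ≤ #R / degX X hX R := by
    rw [le_div_iff₀ m0]
    exact_mod_cast hmX
  have hcY : (#Y : ℝ) ≤ #R / degY Y hY R := by
    rw [le_div_iff₀ m0']
    exact_mod_cast hmY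
  generalize (degX X hX R : ℝ) = m at *
  generalize (degY Y hY R : ℝ) = m' at *
  set r : ℝ := √(m * m' / (loadX X R * loadY Y R)) with hr
  have r0' : 0 < r := Real.sqrt_pos.2 (by positivity)
  have hr2 : r ^ 2 = m * m' / (loadX X R * loadY Y R) := Real.sq_sqrt (by positivity)
  -- This `α` balances the two sides: after `#X ≤ #R / m` and `#Y ≤ #R / m'`, both terms become `#R
  -- / r`.
  have hcard := hA.card_le hε hfX hfY hR hne (α := m / (loadX X R * r)) (by positivity)
  have e1 : m / (loadX X R * r) * loadX X R * (#R / m) = #R / r := by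
    field_simp
  have e2 : (m / (loadX X R * r))⁻¹ * loadY Y R * (#R / m') = #R / r := by
    have : r ^ 2 * (loadX X R * loadY Y R) = m * m' := by
      rw [hr2]
      field_simp
    field_simp
    linarith
  have h5 : m / (loadX X R * r) * loadX X R * #X +
      (m / (loadX X R * r))⁻¹ * loadY Y R * #Y ≤ 2 * (#R / r) := by
    have := mul_le_mul_of_nonneg_left hcX
      (by positivity : 0 ≤ m / (loadX X R * r) * loadX X R)
    have := mul_le_mul_of_nonneg_left hcY
      (by positivity : 0 ≤ (m / (loadX X R * r))⁻¹ * loadY Y R)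
    linarith
  have h6 := hcard.trans (mul_le_mul_of_nonneg_left h5 (by positivity : (0 : ℝ) ≤ A.Q * A.P))
  have h7 : (1 - 2 * ε) ^ 2 / 4 ≤ A.Q * A.P * (2 / r) := by
    refine le_of_mul_le_mul_right (h6.trans_eq ?_) r0
    ring
  rw [← mul_div_assoc, le_div_iff₀ r0'] at h7
  linarith

end Adaptive

/-! ### The bound for non-adaptive queries -/

section NonAdaptive

variable {n : ℕ}

/-- The phases of the oracle `parallelOracle`. -/
noncomputable def parallelPhase {Q w : ℕ} (x : Fin n → Bool) (s : ParBasis n Q w) : ℂ :=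
  (-1) ^ (∑ j, (x (s.1 j).1).toNat * (s.1 j).2.toNat)

theorem norm_parallelPhase {Q w : ℕ} (x : Fin n → Bool) (s : ParBasis n Q w) :
    ‖parallelPhase x s‖ = 1 := by
  simp [parallelPhase]

/-- The fidelity of a circuit without queries. -/
theorem le_fid_of_numQueries_eq_zero {S : Type} [Fintype S] [DecidableEq S] {d e : S → ℂ}
    (hd : ∀ s, ‖d s‖ = 1) (he : ∀ s, ‖e s‖ = 1) (C : List (Step S)) (hC : numQueries C = 0)
    (N : ℕ) (hN : numSamples C = N) (φ ψ : S → ℂ) :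
    (N + 1) * overlap φ ψ - N * normMul φ ψ ≤ fid d e C N φ ψ := by
  -- A two-element index set with a single pair. The weights `1/2` make the loss hypothesis trivial,
  -- since its left side is at most `0`, and with no queries the loss term vanishes from the
  -- conclusion.
  have h := le_sum_fid (fun b : Bool => cond b d e) (fun b => by cases b <;> assumption)
    {(true, false)} {true} {false} (1 / 2) (1 / 2) (by norm_num) (by norm_num) (fun φ => by
      simp only [sum_singleton, cond_true, cond_false]
      have := (overlap_le_normMul (φ true) (φ false)).trans (normMul_le_half_add _ _)
      have : 0 ≤ overlap (phase d (φ true)) (phase e (φ false)) := norm_nonneg _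
      linarith) C N hN (fun b => cond b φ ψ)
  simpa [hC] using h

/-- Two phases can differ at `s` only if one of the `Q` queried positions of `s` separates the
inputs. As `φ` is common to all inputs, the union bound can be summed over `T` for each fixed `s`,
where every position separates at most `L` pairs. -/
theorem card_le_sum_overlap_parallelPhase {Q w : ℕ} {φ : ParBasis n Q w → ℂ}
    (hφ : normSq φ = 1) (T : Finset ((Fin n → Bool) × (Fin n → Bool))) (L : ℕ)
    (hL : ∀ i, #{p ∈ T | p.1 i ≠ p.2 i} ≤ L) :
    (#T : ℝ) - 2 * Q * L ≤
      ∑ p ∈ T, overlap (phase (parallelPhase p.1) φ) (phase (parallelPhase p.2) φ) := by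
  classical
  have hov : overlap φ φ = 1 := by
    rw [overlap, ← ofReal_normSq, hφ]
    simp
  have hl := sum_le_sum fun p (_ : p ∈ T) => overlap_sub_le_overlap_phase
    (norm_parallelPhase (Q := Q) (w := w) p.1) (norm_parallelPhase p.2) φ φ
  simp only [sum_sub_distrib, hov, sum_const, nsmul_eq_mul, mul_one] at hl
  have hpt (p : (Fin n → Bool) × (Fin n → Bool)) (s : ParBasis n Q w) :
      (if parallelPhase p.1 s ≠ parallelPhase p.2 s then 2 * (‖φ s‖ * ‖φ s‖) else 0) ≤
      ∑ j, if p.1 (s.1 j).1 ≠ p.2 (s.1 j).1 then 2 * ‖φ s‖ ^ 2 else 0 := by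
    have h0 (j : Fin Q) : 0 ≤ if p.1 (s.1 j).1 ≠ p.2 (s.1 j).1 then 2 * ‖φ s‖ ^ 2 else 0 := by
      split_ifs <;> positivity
    by_cases h : ∀ j, p.1 (s.1 j).1 = p.2 (s.1 j).1
    · simp [parallelPhase, h]
    · push Not at h
      obtain ⟨j, hj⟩ := h
      refine le_trans ?_ (single_le_sum (fun j _ => h0 j) (mem_univ j))
      rw [if_pos hj]
      split_ifs
      · exact le_of_eq (by ring)
      · positivity
  have hsum : ∑ p ∈ T, ∑ s : ParBasis n Q w,
      (if parallelPhase p.1 s ≠ parallelPhase p.2 s then 2 * (‖φ s‖ * ‖φ s‖) else 0) ≤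
      2 * Q * L := by
    calc _ ≤ ∑ p ∈ T, ∑ s : ParBasis n Q w,
          ∑ j, if p.1 (s.1 j).1 ≠ p.2 (s.1 j).1 then 2 * ‖φ s‖ ^ 2 else 0 :=
          sum_le_sum fun p _ => sum_le_sum fun s _ => hpt p s
      _ = ∑ s : ParBasis n Q w, ∑ j,
          ∑ p ∈ T, if p.1 (s.1 j).1 ≠ p.2 (s.1 j).1 then 2 * ‖φ s‖ ^ 2 else 0 := by
          rw [sum_comm]
          exact sum_congr rfl fun s _ => sum_comm
      _ ≤ ∑ s : ParBasis n Q w, ∑ _j : Fin Q, L * (2 * ‖φ s‖ ^ 2) := by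
          refine sum_le_sum fun s _ => sum_le_sum fun j _ => ?_
          rw [← sum_filter, sum_const, nsmul_eq_mul]
          exact mul_le_mul_of_nonneg_right (by exact_mod_cast hL _) (by positivity)
      _ = 2 * Q * L * normSq φ := by
          simp only [sum_const, card_univ, Fintype.card_fin, nsmul_eq_mul, normSq, mul_sum]
          exact sum_congr rfl fun s _ => by ring
      _ = _ := by rw [hφ, mul_one]
  linarith

theorem NonAdaptiveAlgorithm.Solves.one_le_P {f : (Fin n → Bool) → Bool} {ε : ℝ}
    (hε : ε < 1 / 2) {A : NonAdaptiveAlgorithm n} (hA : A.Solves f ε) {x y : Fin n → Bool}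
    (hx : f x = true) (hy : f y = false) : 1 ≤ A.P := by
  have h1 := hA x
  have h2 := hA y
  rw [hx] at h1
  rw [hy] at h2
  exact pos_of_distinguish A.P A.post
    (samplesProb (parallelOracle x) (A.gates.map fun g => ⟨g, .sample⟩) (A.queriedState x))
    (samplesProb (parallelOracle y) (A.gates.map fun g => ⟨g, .sample⟩) (A.queriedState y))
    ε hε h1 h2

theorem NonAdaptiveAlgorithm.queriedState_eq (A : NonAdaptiveAlgorithm n) (x : Fin n → Bool) :
    A.queriedState x = phase (parallelPhase x)
      ((A.U₀ : Matrix (ParBasis n A.Q A.w) (ParBasis n A.Q A.w) ℂ).mulVec (basisState A.init)) :=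
  rfl

theorem NonAdaptiveAlgorithm.normSq_queriedState (A : NonAdaptiveAlgorithm n)
    (x : Fin n → Bool) : normSq (A.queriedState x) = 1 := by
  rw [A.queriedState_eq, normSq_phase (norm_parallelPhase x), normSq_mulVec, normSq_basisState]

theorem NonAdaptiveAlgorithm.numSamples_gates (A : NonAdaptiveAlgorithm n) :
    numSamples (A.gates.map fun g => ⟨g, .sample⟩) = A.P := by
  simp [numSamples, Step.isQuery, NonAdaptiveAlgorithm.P, List.countP_map, Function.comp_def]

theorem NonAdaptiveAlgorithm.numQueries_gates (A : NonAdaptiveAlgorithm n) :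
    numQueries (A.gates.map fun g => ⟨g, .sample⟩) = 0 := by
  simp [numQueries, Step.isQuery, List.countP_map, Function.comp_def]

theorem NonAdaptiveAlgorithm.Solves.mul_overlap_le {f : (Fin n → Bool) → Bool} {ε : ℝ}
    (hε : ε < 1 / 2) {A : NonAdaptiveAlgorithm n} (hA : A.Solves f ε) {x y : Fin n → Bool}
    (hx : f x = true) (hy : f y = false) :
    (A.P + 1) * overlap (A.queriedState x) (A.queriedState y) - A.P ≤
      1 - (1 - 2 * ε) ^ 2 / 2 := by
  have h1 := hA x
  have h2 := hA y
  rw [hx] at h1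
  rw [hy] at h2
  refine le_trans ?_ (fid_le_of_distinguish (norm_parallelPhase x) (norm_parallelPhase y) _ A.P
    A.numSamples_gates (A.normSq_queriedState x) (A.normSq_queriedState y) A.post ε hε h1 h2)
  have h := le_fid_of_numQueries_eq_zero (norm_parallelPhase x) (norm_parallelPhase y) _
    A.numQueries_gates A.P A.numSamples_gates (A.queriedState x) (A.queriedState y)
  simpa [normMul, A.normSq_queriedState] using h

theorem NonAdaptiveAlgorithm.Solves.card_le {f : (Fin n → Bool) → Bool} {ε : ℝ}
    (hε : ε < 1 / 2) {A : NonAdaptiveAlgorithm n} (hA : A.Solves f ε)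
    (T : Finset ((Fin n → Bool) × (Fin n → Bool))) (hT : ∀ p ∈ T, f p.1 = true ∧ f p.2 = false)
    (L : ℕ) (hL : ∀ i, #{p ∈ T | p.1 i ≠ p.2 i} ≤ L) :
    (1 - 2 * ε) ^ 2 / 8 * #T ≤ A.Q * A.P * L := by
  obtain rfl | hne := T.eq_empty_or_nonempty
  · simp only [card_empty, Nat.cast_zero, mul_zero]
    positivity
  have hP : 1 ≤ A.P := by
    obtain ⟨p, hp⟩ := hne
    exact hA.one_le_P hε (hT p hp).1 (hT p hp).2
  have hsum := sum_le_sum fun p hp => hA.mul_overlap_le hε (hT p hp).1 (hT p hp).2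
  simp only [sum_sub_distrib, ← mul_sum, sum_const, nsmul_eq_mul] at hsum
  have hφ := normSq_mulVec A.U₀ (basisState A.init)
  rw [normSq_basisState] at hφ
  have hov := mul_le_mul_of_nonneg_left (card_le_sum_overlap_parallelPhase hφ T L hL)
    (by positivity : (0 : ℝ) ≤ A.P + 1)
  simp only [← A.queriedState_eq] at hov
  have hP' : (A.P : ℝ) + 1 ≤ 2 * A.P := by
    have : (1 : ℝ) ≤ A.P := by exact_mod_cast hP
    linarith
  have h1 := mul_le_mul_of_nonneg_right hP' (by positivity : (0 : ℝ) ≤ 2 * A.Q * L)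
  linarith

theorem NonAdaptiveAlgorithm.Solves.max_le {f : (Fin n → Bool) → Bool} {ε : ℝ}
    (hε : ε < 1 / 2) {A : NonAdaptiveAlgorithm n} (hA : A.Solves f ε)
    {X Y : Finset (Fin n → Bool)} (hX : X.Nonempty)
    (hY : Y.Nonempty) {R : Finset ((Fin n → Bool) × (Fin n → Bool))}
    (hfX : ∀ x ∈ X, f x = true) (hfY : ∀ y ∈ Y, f y = false) (hR : R ⊆ X ×ˢ Y) :
    (1 - 2 * ε) ^ 2 / 8 * max ((degX X hX R : ℝ) / (loadX X R : ℝ))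
      ((degY Y hY R : ℝ) / (loadY Y R : ℝ)) ≤ A.Q * A.P := by
  have hf (p) (hp : p ∈ R) : f p.1 = true ∧ f p.2 = false :=
    ⟨hfX _ (mem_product.1 (hR hp)).1, hfY _ (mem_product.1 (hR hp)).2⟩
  -- To be applied to the pairs through one fixed `x`, or one fixed `y`: a single fibre has at least
  -- `m` pairs, and each position separates at most `L` of them.
  have key (T : Finset ((Fin n → Bool) × (Fin n → Bool))) (hTR : T ⊆ R) (L m : ℕ) (hm : m ≤ #T)
      (hL : ∀ i, #{p ∈ T | p.1 i ≠ p.2 i} ≤ L) :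
      (1 - 2 * ε) ^ 2 / 8 * ((m : ℝ) / L) ≤ A.Q * A.P := by
    have h := hA.card_le hε T (fun p hp => hf p (hTR hp)) L hL
    obtain rfl | hL0 := L.eq_zero_or_pos
    · simp only [Nat.cast_zero, div_zero, mul_zero]
      positivity
    · rw [← mul_div_assoc, div_le_iff₀ (by exact_mod_cast hL0)]
      refine le_trans ?_ h
      gcongr
  rw [mul_max_of_nonneg _ _ (by positivity)]
  refine _root_.max_le ?_ ?_
  · obtain ⟨x, hx⟩ := hX
    refine key {p ∈ R | p.1 = x} (filter_subset _ _) _ _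
      (degX_le R ⟨x, hx⟩ hx) fun i => ?_
    rw [filter_filter]
    exact card_filter_le_loadX R hx i
  · obtain ⟨y, hy⟩ := hY
    refine key {p ∈ R | p.2 = y} (filter_subset _ _) _ _
      (degY_le R ⟨y, hy⟩ hy) fun i => ?_
    rw [filter_filter]
    exact card_filter_le_loadY R hy i

end NonAdaptive

end PDQP

theorem mainTheorem7 (ε : ℝ) (hε₀ : 0 ≤ ε) (hε : ε < 1 / 2) :
    ∃ c : ℝ, 0 < c ∧
      ∀ (n : ℕ) (f : (Fin n → Bool) → Bool)
        (X Y : Finset (Fin n → Bool)) (hX : X.Nonempty) (hY : Y.Nonempty)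
        (R : Finset ((Fin n → Bool) × (Fin n → Bool))),
        (∀ x ∈ X, f x = true) → (∀ y ∈ Y, f y = false) → R ⊆ X ×ˢ Y →
        (∀ A : PDQP.Algorithm n, A.Solves f ε →
          c * Real.sqrt (((PDQP.degX X hX R : ℝ) * (PDQP.degY Y hY R : ℝ)) /
              ((PDQP.loadX X R : ℝ) * (PDQP.loadY Y R : ℝ))) ≤ (A.Q : ℝ) * (A.P : ℝ)) ∧
        (∀ A : PDQP.NonAdaptiveAlgorithm n, A.Solves f ε →
          c * max ((PDQP.degX X hX R : ℝ) / (PDQP.loadX X R : ℝ))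
              ((PDQP.degY Y hY R : ℝ) / (PDQP.loadY Y R : ℝ)) ≤ (A.Q : ℝ) * (A.P : ℝ)) := by
  refine ⟨(1 - 2 * ε) ^ 2 / 8, ?_, fun n f X Y hX hY R hfX hfY hR => ⟨fun A hA => ?_,
    fun A hA => ?_⟩⟩
  · have : 0 < 1 - 2 * ε := by linarith
    positivity
  · exact hA.sqrt_le hε hX hY hfX hfY hR
  · exact hA.max_le hε hX hY hfX hfY hR
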